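/- There are $S\ge 2$ non-colluding servers, each storing the same $N\ge 1$ independent, uniformly distributed files $W_1,\dots,W_N$ of equal size (taken as the unit of data), there are $C$ caches, each able to store $M$ files, and there are $K=\binom{C}{L}$ users, $1\le L<C$, one for every set of $L$ caches; a user has access to the caches in its set. Assume that $t=CM/N\in\{0,1,\dots,C\}$ is an integer. A scheme with uncoded placement works as follows. Each file consists of $B$ symbols of a finite alphabet, and each cache stores some of the file symbols, at most $MB$ of them; $Z_c$ is the content of cache $c$. Every user $k$ then demands a file $W_{d_k}$; let $\mathbf d$ be the demand vector. The users jointly generate one query $Q_s^{\mathbf d}$ for each server $s$, as a function of $\mathbf d$, the cache contents, and randomness that is independent of the files and the demands. Server $s$ broadcasts an answer $A_s^{\mathbf d}$, a function of its query and of the files. The scheme is private if $I(\mathbf d;\,Q_s^{\mathbf d},Z_1,\dots,Z_C)=0$ for every $s$, and correct if each user $k$ can determine $W_{d_k}$ with zero error from $\mathbf d$, the users' randomness, the contents of its $L$ caches and all the answers. Its worst-case rate is $\max_{\mathbf d}\sum_{s=1}^S H(A_s^{\mathbf d})$, measured in units of the size of one file. Let $R^*(t)$ be the infimum of the worst-case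 rates of all private and correct schemes with uncoded placement (over all file lengths $B$ and all alphabets), and let $$R(t)=\frac{\binom{C}{t+L}}{\binom{C}{t}}\left(1+\frac1S+\frac1{S^2}+\dots+\frac1{S^{N-1}}\right).$$ Theorem. If $N\ge\binom{C-t}{L}$ (in particular, if there are at least as many files as users, $N\ge K=\binom{C}{L}$), then $$R(t)\le 2R^*(t).$$ -/

import Mathlib

noncomputable section

namespace MuPIR

/-- Shannon entropy (in nats) of a random variable `X` with finitely many values. -/
def entropy {Ω α : Type} [Fintype α] (P : PMF Ω) (X : Ω → α) : ℝ :=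
  ∑ a, Real.negMulLog ((P.map X) a).toReal

/-- Conditional entropy `H(X | Y) = H(X, Y) - H(Y)`. -/
def condEntropy {Ω α β : Type} [Fintype α] [Fintype β] (P : PMF Ω) (X : Ω → α) (Y : Ω → β) : ℝ :=
  entropy P (fun ω => (X ω, Y ω)) - entropy P Y

/-- Mutual information `I(X ; Y) = H(X) + H(Y) - H(X, Y)`. -/
def mutualInfo {Ω α β : Type} [Fintype α] [Fintype β] (P : PMF Ω) (X : Ω → α) (Y : Ω → β) : ℝ :=
  entropy P X + entropy P Y - entropy P (fun ω => (X ω, Y ω))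

/-- The `N` files, each consisting of `B` symbols from an alphabet with `q` letters. -/
abbrev Library (N B q : ℕ) : Type := Fin N → Fin B → Fin q

/-- The users: one for every set of `L` of the `C` caches (the caches that the user accesses). -/
abbrev User (C L : ℕ) : Type := {U : Finset (Fin C) // U.card = L}

/-- Demand vectors: every user asks for one of the `N` files. -/
abbrev Demand (N C L : ℕ) : Type := User C L → Fin N

/-- What cache `c` holds under an uncoded placement: the file symbols at the positions
`cached c`, where the position `(n, j)` is the `j`-th symbol of file `n`. -/
abbrev CacheContent {N C B : ℕ} (q : ℕ) (cached : Fin C → Finset (Fin N × Fin B))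
    (c : Fin C) : Type :=
  {x : Fin N × Fin B // x ∈ cached c} → Fin q

/-- A placement and delivery scheme with uncoded cache placement, for `S` servers, `N` files of
`B` symbols over `q` letters, `C` caches and the `C.choose L` users. The users generate the
queries jointly from the demands, the cache contents and shared randomness; the answer of a server
is a function of its query and of the files. -/
structure Scheme (S N C L B q : ℕ) where
  /-- positions of the file symbols that are stored in each cache -/
  cached : Fin C → Finset (Fin N × Fin B)
  /-- number of values of the users' randomness -/
  randSize : ℕ
  /-- law of the users' randomness -/
  randLaw : PMF (Fin randSize)
  /-- size of the query alphabet -/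
  querySize : ℕ
  /-- the query to each server -/
  query : Fin S → Demand N C L → (∀ c, CacheContent q cached c) → Fin randSize → Fin querySize
  /-- size of the answer alphabet -/
  answerSize : ℕ
  /-- the answer of each server -/
  answer : Fin S → Fin querySize → Library N B q → Fin answerSize

namespace Scheme

variable {S N C L B q : ℕ}

/-- `Z_c`, as a function of the files. -/
def Z (σ : Scheme S N C L B q) (W : Library N B q) (c : Fin C) : CacheContent q σ.cached c :=
  fun x => W x.1.1 x.1.2

/-- `Q_s` under demand vector `d`, as a function of the files and of the users' randomness. -/
def Q (σ : Scheme S N C L B q) (s : Fin S) (d : Demand N C L)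
    (x : Library N B q × Fin σ.randSize) : Fin σ.querySize :=
  σ.query s d (σ.Z x.1) x.2

/-- `A_s` under demand vector `d`, as a function of the files and of the users' randomness. -/
def A (σ : Scheme S N C L B q) (s : Fin S) (d : Demand N C L)
    (x : Library N B q × Fin σ.randSize) : Fin σ.answerSize :=
  σ.answer s (σ.Q s d x) x.1

/-- Joint law of the files (independent and uniform) and of the users' randomness, which is
independent of the files. -/
def law [NeZero q] (σ : Scheme S N C L B q) : PMF (Library N B q × Fin σ.randSize) :=
  (PMF.uniformOfFintype (Library N B q)).bind fun W => σ.randLaw.map fun r => (W, r)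

/-- Joint law of the demand vector (uniform), the files and the users' randomness, where the
demand vector is independent of the rest. -/
def fullLaw [NeZero N] [NeZero q] (σ : Scheme S N C L B q) :
    PMF (Demand N C L × (Library N B q × Fin σ.randSize)) :=
  (PMF.uniformOfFintype (Demand N C L)).bind fun d => σ.law.map fun x => (d, x)

/-- No cache holds more than `M` files: `M * B` symbols, as a file has `B` symbols. -/
def FitsMemory (σ : Scheme S N C L B q) (M : ℝ) : Prop :=
  ∀ c, ((σ.cached c).card : ℝ) ≤ M * B

/-- Privacy: `I(d ; Q_s, Z_{[1:C]}) = 0` for every server `s`. -/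
def IsPrivate [NeZero N] [NeZero q] (σ : Scheme S N C L B q) : Prop :=
  ∀ s : Fin S, mutualInfo σ.fullLaw (fun y => y.1) (fun y => (σ.Q s y.1 y.2, σ.Z y.2.1)) = 0

/-- Correctness: for every user `k`, the demanded file `W_{d_k}` is determined by the demand
vector, the users' own randomness, the caches that the user accesses, and all the answers. -/
def IsCorrect [NeZero N] [NeZero q] (σ : Scheme S N C L B q) : Prop :=
  ∀ k : User C L, condEntropy σ.fullLaw (fun y => y.2.1 (y.1 k))
    (fun y => (y.1, y.2.2, (fun c : {c // c ∈ k.1} => σ.Z y.2.1 c.1), fun s => σ.A s y.1 y.2)) = 0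

/-- The rate under demand vector `d`: the sum of the entropies of the answers, in units of the
size `B * log q` of one file. -/
def rate [NeZero q] (σ : Scheme S N C L B q) (d : Demand N C L) : ℝ :=
  (∑ s, entropy σ.law (σ.A s d)) / (B * Real.log q)

/-- The rate under the worst demand vector. -/
def worstCaseRate [NeZero q] (σ : Scheme S N C L B q) : ℝ :=
  ⨆ d : Demand N C L, σ.rate d

end Scheme

/-- The worst-case rates of all private and correct schemes with uncoded placement and cache
memory `M` (in files), for every file length and every alphabet. -/
def achievableRates (S N C L : ℕ) [NeZero N] (M : ℝ) : Set ℝ :=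
  {R | ∃ (B q : ℕ) (_ : NeZero q) (σ : Scheme S N C L B q), 0 < B ∧ 2 ≤ q ∧
    σ.FitsMemory M ∧ σ.IsPrivate ∧ σ.IsCorrect ∧ R = σ.worstCaseRate}

/-- The optimal worst-case private rate `R*` under uncoded placement, at cache memory `M`. -/
def optimalRate (S N C L : ℕ) [NeZero N] (M : ℝ) : ℝ :=
  sInf (achievableRates S N C L M)

/-- `R(t) = (C choose t+L) / (C choose t) * (1 + 1/S + ⋯ + 1/S^(N-1))`. -/
def schemeRate (S N C L t : ℕ) : ℝ :=
  (C.choose (t + L) : ℝ) / (C.choose t : ℝ) * ∑ n ∈ Finset.range N, 1 / (S : ℝ) ^ n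

end MuPIR

end

/-! The geometric factor of `schemeRate` is at most 2 because `S ≥ 2`, so it suffices to show that
`R*` is at least `C.choose (t + L) / C.choose t`. This converse (`Scheme.le_worstCaseRate`) holds
even without privacy.

Fix an order of the caches and reveal them one at a time; user `U` can decode once its last cache,
number `U.last`, is revealed. Call a symbol of the file demanded by `U` missing if none of the first
`U.last` caches holds it. The other symbols and the answers yield the missing ones user by user, so
the answer entropies sum to at least `log q` per missing symbol (`card_missing_mul_log_le`).

Let the users with `U.last ≤ C - t` demand distinct files, and average over cache orders and cyclic
shifts of the files. A symbol held by `h` caches avoids the first `i` with probability `(C -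
h).choose i / C.choose i`. This is convex in `h`, and the memory limit bounds the mean of `h` by
`t`, so the average is at least `(C - t).choose i / C.choose i = (C - i).choose t / C.choose t`.
Summing over users with `i = U.last` gives `C.choose (t + L) / C.choose t`. -/

noncomputable section
namespace MuPIR

/-! ### Entropy of finite random variables -/

variable {Ω α β : Type} [Fintype Ω]

/-- The probability that the random variable `X` takes the value `a`. -/
def mass (P : PMF Ω) (X : Ω → α) (a : α) : ℝ :=
  ((P.map X) a).toReal

open scoped Classical in
theorem mass_eq_sum (P : PMF Ω) (X : Ω → α) (a : α) :
    mass P X a = ∑ ω, if X ω = a then (P ω).toReal else 0 := by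
  rw [mass, PMF.map_apply, tsum_fintype, ENNReal.toReal_sum]
  · refine Finset.sum_congr rfl fun ω _ => ?_
    by_cases h : X ω = a
    · simp [h]
    · simp [h, Ne.symm h]
  · intro ω _
    split_ifs
    · exact P.apply_ne_top ω
    · simp

theorem sum_toReal_eq_one (P : PMF Ω) : ∑ ω, (P ω).toReal = 1 := by
  rw [← ENNReal.toReal_sum fun ω _ => P.apply_ne_top ω, ← tsum_fintype (L := .unconditional _),
    P.tsum_coe, ENNReal.toReal_one]

theorem mass_nonneg {Ω α : Type} (P : PMF Ω) (X : Ω → α) (a : α) : 0 ≤ mass P X a :=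
  ENNReal.toReal_nonneg

theorem sum_mass {Ω α : Type} [Fintype α] (P : PMF Ω) (X : Ω → α) : ∑ a, mass P X a = 1 :=
  sum_toReal_eq_one (P.map X)

theorem sum_mass_mul [Fintype α] (P : PMF Ω) (X : Ω → α) (f : α → ℝ) :
    ∑ a, mass P X a * f a = ∑ ω, (P ω).toReal * f (X ω) := by
  classical
  simp_rw [mass_eq_sum, Finset.sum_mul]
  rw [Finset.sum_comm]
  refine Finset.sum_congr rfl fun ω _ => ?_
  simp

/-- The entropy is the mean of the self-information. -/
theorem entropy_eq_sum [Fintype α] (P : PMF Ω) (X : Ω → α) :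
    entropy P X = ∑ ω, (P ω).toReal * -Real.log (mass P X (X ω)) := by
  rw [← sum_mass_mul P X fun a => -Real.log (mass P X a)]
  refine Finset.sum_congr rfl fun a _ => ?_
  rw [Real.negMulLog, mass]
  ring

theorem toReal_le_mass (P : PMF Ω) (X : Ω → α) (ω : Ω) : (P ω).toReal ≤ mass P X (X ω) := by
  classical
  rw [mass_eq_sum]
  refine le_trans (by simp) (Finset.single_le_sum (f := fun ω' =>
    if X ω' = X ω then (P ω').toReal else 0) (fun ω' _ => ?_) (Finset.mem_univ ω))
  split_ifs
  · exact ENNReal.toReal_nonneg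
  · exact le_rfl

theorem mass_prod_le (P : PMF Ω) (X : Ω → α) (Y : Ω → β) (a : α) (b : β) :
    mass P (fun ω => (X ω, Y ω)) (a, b) ≤ mass P Y b := by
  classical
  rw [mass_eq_sum, mass_eq_sum]
  refine Finset.sum_le_sum fun ω _ => ?_
  have := ENNReal.toReal_nonneg (a := P ω)
  by_cases h : Y ω = b <;> by_cases h' : X ω = a <;> simp [h, h']

/-- A random variable that is a function of another one does not add to the joint entropy. -/
theorem entropy_prod_of_determined [Fintype α] [Fintype β] (P : PMF Ω) (X : Ω → α) (Y : Ω → β)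
    (h : ∀ ω ω', Y ω = Y ω' → X ω = X ω') :
    entropy P (fun ω => (X ω, Y ω)) = entropy P Y := by
  classical
  rw [entropy_eq_sum, entropy_eq_sum]
  refine Finset.sum_congr rfl fun ω _ => ?_
  rw [mass_eq_sum, mass_eq_sum]
  congr 3
  refine Finset.sum_congr rfl fun ω' _ => ?_
  by_cases hY : Y ω' = Y ω
  · simp [hY, h _ _ hY]
  · simp [hY]

theorem entropy_prod_comm [Fintype α] [Fintype β] (P : PMF Ω) (X : Ω → α) (Y : Ω → β) :
    entropy P (fun ω => (X ω, Y ω)) = entropy P (fun ω => (Y ω, X ω)) := by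
  classical
  rw [entropy_eq_sum, entropy_eq_sum]
  refine Finset.sum_congr rfl fun ω _ => ?_
  simp only [mass_eq_sum, Prod.mk.injEq, and_comm]

theorem entropy_of_subsingleton [Fintype α] [Subsingleton α] (P : PMF Ω) (X : Ω → α) :
    entropy P X = 0 := by
  classical
  rw [entropy_eq_sum]
  refine Finset.sum_eq_zero fun ω _ => ?_
  rw [mass_eq_sum]
  simp [Subsingleton.elim (X _) (X ω), sum_toReal_eq_one]

theorem mutualInfo_of_subsingleton [Fintype α] [Fintype β] [Subsingleton β] (P : PMF Ω)
    (X : Ω → α) (Y : Ω → β) : mutualInfo P X Y = 0 := by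
  rw [mutualInfo, entropy_of_subsingleton P Y, entropy_prod_comm,
    entropy_prod_of_determined P Y X fun _ _ _ => Subsingleton.elim _ _]
  ring

/-- If `H(X | Y) = 0`, then `Y` determines `X` on the support. -/
theorem eq_of_condEntropy_eq_zero [Fintype α] [Fintype β] (P : PMF Ω) (X : Ω → α) (Y : Ω → β)
    (h : condEntropy P X Y = 0) {ω ω' : Ω} (hω : P ω ≠ 0) (hω' : P ω' ≠ 0) (hY : Y ω = Y ω') :
    X ω = X ω' := by
  classical
  have pos : ∀ {ω}, P ω ≠ 0 → 0 < (P ω).toReal := fun {ω} h =>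
    ENNReal.toReal_pos h (P.apply_ne_top ω)
  rw [condEntropy, entropy_eq_sum, entropy_eq_sum, ← Finset.sum_sub_distrib] at h
  have hnn : ∀ ω ∈ Finset.univ, 0 ≤ (P ω).toReal *
      -Real.log (mass P (fun ω => (X ω, Y ω)) (X ω, Y ω)) -
        (P ω).toReal * -Real.log (mass P Y (Y ω)) := by
    intro ω _
    by_cases h0 : P ω = 0
    · simp [h0]
    rw [← mul_sub]
    refine mul_nonneg ENNReal.toReal_nonneg ?_
    have h1 : 0 < mass P (fun ω => (X ω, Y ω)) (X ω, Y ω) :=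
      (pos h0).trans_le (toReal_le_mass P (fun ω => (X ω, Y ω)) ω)
    have := Real.log_le_log h1 (mass_prod_le P X Y (X ω) (Y ω))
    linarith
  have hz := (Finset.sum_eq_zero_iff_of_nonneg hnn).1 h ω (Finset.mem_univ ω)
  rw [← mul_sub, mul_eq_zero, or_iff_right (pos hω).ne'] at hz
  have h1 : 0 < mass P (fun ω => (X ω, Y ω)) (X ω, Y ω) :=
    (pos hω).trans_le (toReal_le_mass P (fun ω => (X ω, Y ω)) ω)
  have h2 : 0 < mass P Y (Y ω) := (pos hω).trans_le (toReal_le_mass P Y ω)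
  have heq : mass P (fun ω => (X ω, Y ω)) (X ω, Y ω) = mass P Y (Y ω) :=
    Real.log_injOn_pos h1 h2 (by linarith)
  -- If `X` differed at `ω'`, then `ω'` would count towards the mass of `Y` but not towards the
  -- joint mass, making the latter strictly smaller.
  by_contra hX
  rw [mass_eq_sum, mass_eq_sum] at heq
  refine absurd heq (ne_of_lt (Finset.sum_lt_sum (fun ω₁ _ => ?_) ⟨ω', Finset.mem_univ _, ?_⟩))
  · have := ENNReal.toReal_nonneg (a := P ω₁)
    by_cases h : Y ω₁ = Y ω <;> by_cases h' : X ω₁ = X ω <;> simp [h, h']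
  · simp [hY, Ne.symm hX, pos hω']

/-- If no tuple of values has probability above `p`, then the entropies of the components
add up to at least `-log p`. -/
theorem neg_log_le_sum_entropy {ι : Type} [Fintype ι] [Fintype α] (P : PMF Ω) (X : ι → Ω → α)
    {p : ℝ} (hp : 0 < p) (h : ∀ v : ι → α, mass P (fun ω i => X i ω) v ≤ p) :
    -Real.log p ≤ ∑ i, entropy P (X i) := by
  classical
  have hsum : ∑ ω, (P ω).toReal * ∏ i, mass P (X i) (X i ω) ≤ p := by
    rw [← sum_mass_mul P (fun ω i => X i ω) fun v => ∏ i, mass P (X i) (v i)]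
    calc _ ≤ ∑ v : ι → α, p * ∏ i, mass P (X i) (v i) :=
          Finset.sum_le_sum fun v _ => mul_le_mul_of_nonneg_right (h v)
            (Finset.prod_nonneg fun i _ => mass_nonneg _ _ _)
      _ = p := by
          rw [← Finset.mul_sum, ← Fintype.prod_sum]
          simp [sum_mass]
  -- This is `log x ≤ x - 1` at `x = (∏ i, mass P (X i) (X i ω)) / p`, whose mean is at most 1 by
  -- `hsum`.
  have key : ∀ ω, (P ω).toReal * (1 - (∏ i, mass P (X i) (X i ω)) / p - Real.log p) ≤
      ∑ i, (P ω).toReal * -Real.log (mass P (X i) (X i ω)) := by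
    intro ω
    by_cases h0 : P ω = 0
    · simp [h0]
    have hpos : ∀ i, 0 < mass P (X i) (X i ω) := fun i =>
      (ENNReal.toReal_pos h0 (P.apply_ne_top ω)).trans_le (toReal_le_mass P (X i) ω)
    rw [← Finset.mul_sum]
    refine mul_le_mul_of_nonneg_left ?_ ENNReal.toReal_nonneg
    have hprod : 0 < ∏ i, mass P (X i) (X i ω) := Finset.prod_pos fun i _ => hpos i
    have hlog := Real.log_le_sub_one_of_pos (div_pos hprod hp)
    rw [Real.log_div hprod.ne' hp.ne', Real.log_prod fun i _ => (hpos i).ne'] at hlog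
    rw [Finset.sum_neg_distrib]
    linarith
  simp_rw [entropy_eq_sum]
  rw [Finset.sum_comm]
  refine le_trans ?_ (Finset.sum_le_sum fun ω _ => key ω)
  have : ∑ ω, (P ω).toReal * (1 - (∏ i, mass P (X i) (X i ω)) / p - Real.log p) =
      (1 - Real.log p) * ∑ ω, (P ω).toReal -
        (∑ ω, (P ω).toReal * ∏ i, mass P (X i) (X i ω)) / p := by
    rw [Finset.mul_sum, Finset.sum_div, ← Finset.sum_sub_distrib]
    refine Finset.sum_congr rfl fun ω _ => ?_
    ring
  rw [this, sum_toReal_eq_one]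
  have := (div_le_one hp).2 hsum
  linarith

end MuPIR
end

/-! ### Binomial convexity and averages over permutations -/

namespace MuPIR

/-- The tangent line bound for the convex function `m ↦ m.choose i`. -/
theorem choose_add_mul_le_choose (m₀ m i : ℕ) (hi : 1 ≤ i) :
    (m₀.choose i : ℝ) + ((m : ℝ) - m₀) * m₀.choose (i - 1) ≤ m.choose i := by
  obtain ⟨i, rfl⟩ := Nat.exists_eq_add_of_le' hi
  simp only [Nat.add_sub_cancel]
  -- By Pascal's rule the increments of `m ↦ m.choose (i + 1)` are `m.choose i`, which grow with
  -- `m`: at least the slope `m₀.choose i` from `m₀` on, at most that slope before it.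
  rcases le_total m₀ m with h | h
  · induction m, h using Nat.le_induction with
    | base => simp
    | succ m hm ih =>
      have h1 : (m₀.choose i : ℝ) ≤ m.choose i := by exact_mod_cast Nat.choose_le_choose i hm
      rw [Nat.choose_succ_succ]
      push_cast
      linarith
  · obtain ⟨k, rfl⟩ := Nat.exists_eq_add_of_le h
    have key : ∀ j ≤ k, ((m + j).choose (i + 1) : ℝ) ≤
        m.choose (i + 1) + j * (m + k).choose i := by
      intro j hj
      induction j with
      | zero => simp
      | succ j ih =>
        have h1 : ((m + j).choose i : ℝ) ≤ (m + k).choose i := by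
          exact_mod_cast Nat.choose_le_choose i (by omega)
        have := ih (by omega)
        rw [← add_assoc, Nat.choose_succ_succ]
        push_cast
        linarith
    have := key k le_rfl
    push_cast
    linarith

/-- If the sizes have mean at most `t`, the mean of `(C - size).choose i` is at least
`(C - t).choose i`. -/
theorem card_mul_choose_le_sum_choose {ι : Type} [Fintype ι] {C t i : ℕ} (hi : 1 ≤ i)
    (htC : t ≤ C) (f : ι → ℕ) (hf : ∀ x, f x ≤ C)
    (hsum : (∑ x, (f x : ℝ)) ≤ t * Fintype.card ι) :
    (Fintype.card ι : ℝ) * (C - t).choose i ≤ ∑ x, ((C - f x).choose i : ℝ) := by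
  -- Tangent at `C - t`; the linear terms have a nonnegative sum by `hsum`.
  have h : ∀ x, ((C - t).choose i : ℝ) + ((t : ℝ) - f x) * (C - t).choose (i - 1) ≤
      (C - f x).choose i := by
    intro x
    have := choose_add_mul_le_choose (C - t) (C - f x) i hi
    rw [Nat.cast_sub (hf x), Nat.cast_sub htC] at this
    linarith
  refine le_trans ?_ (Finset.sum_le_sum fun x _ => h x)
  rw [Finset.sum_add_distrib, ← Finset.sum_mul, Finset.sum_sub_distrib]
  simp only [Finset.sum_const, Finset.card_univ, nsmul_eq_mul]
  have := mul_nonneg (sub_nonneg.2 hsum) (Nat.cast_nonneg (α := ℝ) ((C - t).choose (i - 1)))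
  linarith

/-- One more than the largest element of a set of naturals, and `0` for the empty set. -/
def height (U : Finset ℕ) : ℕ := U.sup fun c => c + 1

/-- Split a `(t + L)`-subset of `range C` into its `L` smallest elements `U` and the other `t`,
which lie among the `C - height U` numbers above `U`. The proof replaces this bijection by induction
with Pascal's rule. -/
theorem sum_choose_sub_height (C L t : ℕ) (hL : 1 ≤ L) :
    ∑ U ∈ (Finset.range C).powersetCard L, (C - height U).choose t = C.choose (t + L) := by
  induction C generalizing t with
  | zero =>
    rw [Finset.powersetCard_eq_empty.2 (by simpa using (show 0 < L from hL)), Finset.sum_empty,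
      Nat.choose_eq_zero_of_lt (by omega)]
  | succ C ih =>
    cases t with
    | zero => simp
    | succ t =>
      have hle : ∀ U ∈ (Finset.range C).powersetCard L, height U ≤ C := fun U hU =>
        Finset.sup_le fun c hc =>
          Finset.mem_range.1 ((Finset.mem_powersetCard.1 hU).1 hc)
      have hsub : (Finset.range C).powersetCard L ⊆ (Finset.range (C + 1)).powersetCard L :=
        Finset.powersetCard_mono (Finset.range_mono (Nat.le_succ C))
      rw [← Finset.sum_subset hsub]
      · rw [show t + 1 + L = t + L + 1 by ring, Nat.choose_succ_succ', ← ih t,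
          show t + L + 1 = t + 1 + L by ring, ← ih (t + 1), ← Finset.sum_add_distrib]
        refine Finset.sum_congr rfl fun U hU => ?_
        rw [Nat.succ_sub (hle U hU), Nat.choose_succ_succ]
      · intro U hU hU'
        have hC : C ∈ U := by
          by_contra hC
          refine hU' (Finset.mem_powersetCard.2 ⟨fun c hc => ?_, (Finset.mem_powersetCard.1 hU).2⟩)
          have h1 := Finset.mem_range.1 ((Finset.mem_powersetCard.1 hU).1 hc)
          have h2 : c ≠ C := fun h => hC (h ▸ hc)
          exact Finset.mem_range.2 (by omega)
        have : C + 1 ≤ height U := Finset.le_sup (f := fun c => c + 1) hC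
        rw [Nat.sub_eq_zero_of_le this]
        simp

/-- Averaging a function of the image of `F` over all permutations is averaging it over all sets
of the size of `F`. -/
theorem sum_perm_map {α : Type} [Fintype α] [DecidableEq α] (F : Finset α) (g : Finset α → ℝ) :
    ((Fintype.card α).choose F.card : ℝ) * ∑ π : Equiv.Perm α, g (F.map π.toEmbedding) =
      (Fintype.card α).factorial * ∑ I ∈ Finset.univ.powersetCard F.card, g I := by
  have hswap : ∀ π : Equiv.Perm α, ∑ I ∈ Finset.univ.powersetCard F.card, g (I.map π.toEmbedding) =
      ∑ I ∈ Finset.univ.powersetCard F.card, g I := by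
    intro π
    refine Finset.sum_bij' (fun I _ => I.map π.toEmbedding) (fun I _ => I.map π.symm.toEmbedding)
      ?_ ?_ ?_ ?_ ?_
    · intro I hI; simpa [Finset.mem_powersetCard] using hI
    · intro I hI; simpa [Finset.mem_powersetCard] using hI
    · intro I _; simp [Finset.map_map]
    · intro I _; simp [Finset.map_map]
    · intro I _; rfl
  have hconst : ∀ I ∈ (Finset.univ : Finset α).powersetCard F.card,
      ∑ π : Equiv.Perm α, g (I.map π.toEmbedding) =
        ∑ π : Equiv.Perm α, g (F.map π.toEmbedding) := by
    intro I hI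
    have hcard : F.card = I.card := (Finset.mem_powersetCard.1 hI).2.symm
    let e : {x // x ∈ F} ≃ {x // x ∈ I} := Finset.equivOfCardEq hcard
    let σ : Equiv.Perm α := e.extendSubtype
    have hσ : F.map σ.toEmbedding = I := by
      refine Finset.eq_of_subset_of_card_le ?_ (by simp [hcard])
      intro x hx
      obtain ⟨y, hy, rfl⟩ := Finset.mem_map.1 hx
      exact e.extendSubtype_mem y hy
    rw [← hσ, ← Equiv.sum_comp (Equiv.mulRight σ) fun π => g (F.map π.toEmbedding)]
    refine Finset.sum_congr rfl fun π _ => ?_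
    rw [Finset.map_map]
    rfl
  -- Double counting over pairs `(I, π)`: the sum over `π` does not depend on `I`, and the sum over
  -- `I` does not depend on `π`.
  calc _ = ∑ I ∈ (Finset.univ : Finset α).powersetCard F.card,
        ∑ π : Equiv.Perm α, g (I.map π.toEmbedding) := by
        rw [Finset.sum_congr rfl hconst]
        simp
    _ = _ := by
        rw [Finset.sum_comm, Finset.sum_congr rfl fun π _ => hswap π]
        simp [Fintype.card_perm]

/-- The number of permutations that move `F` off `T`. -/
theorem choose_mul_card_perm_disjoint {α : Type} [Fintype α] [DecidableEq α] (F T : Finset α) :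
    ((Fintype.card α).choose F.card : ℝ) *
      ∑ π : Equiv.Perm α, (if Disjoint (F.map π.toEmbedding) T then 1 else 0) =
      (Fintype.card α).factorial * (Fintype.card α - T.card).choose F.card := by
  rw [sum_perm_map F fun I => if Disjoint I T then 1 else 0]
  congr 1
  rw [Finset.sum_boole, ← Finset.card_compl, ← Finset.card_powersetCard]
  congr 2
  ext I
  simp only [Finset.mem_filter, Finset.mem_powersetCard, Finset.subset_univ, true_and,
    Finset.subset_compl_iff_disjoint_right, and_comm]

end MuPIR

/-! ### The acyclic index coding bound -/

noncomputable section
namespace MuPIR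

theorem bind_map_mk_apply {α β : Type} (p : PMF α) (q : PMF β) (a : α) (b : β) :
    (p.bind fun a => q.map fun b => (a, b)) (a, b) = p a * q b := by
  rw [PMF.bind_apply, tsum_eq_single a, PMF.map_apply, tsum_eq_single b]
  · simp
  · intro b' h
    simp [Ne.symm h]
  · intro a' h
    rw [PMF.map_apply]
    simp [Ne.symm h]

namespace Scheme

variable {S N C L B q : ℕ}

theorem law_apply [NeZero q] (σ : Scheme S N C L B q) (W : Library N B q)
    (r : Fin σ.randSize) :
    σ.law (W, r) = (Fintype.card (Library N B q) : ENNReal)⁻¹ * σ.randLaw r := by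
  rw [law, bind_map_mk_apply, PMF.uniformOfFintype_apply]

theorem fullLaw_apply_ne_zero [NeZero N] [NeZero q] (σ : Scheme S N C L B q) (d : Demand N C L)
    (W : Library N B q) {r : Fin σ.randSize} (hr : σ.randLaw r ≠ 0) :
    σ.fullLaw (d, W, r) ≠ 0 := by
  rw [fullLaw, bind_map_mk_apply, law_apply, PMF.uniformOfFintype_apply]
  exact mul_ne_zero (by simp) (mul_ne_zero (by simp) hr)

/-- In a correct scheme, users decode the same file from libraries that give the same answers and
the same contents of their caches. -/
theorem IsCorrect.decode [NeZero N] [NeZero q] {σ : Scheme S N C L B q} (hσ : σ.IsCorrect)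
    (d : Demand N C L) {r : Fin σ.randSize} (hr : σ.randLaw r ≠ 0) {W W' : Library N B q}
    (hA : ∀ s, σ.A s d (W, r) = σ.A s d (W', r)) (k : User C L)
    (hZ : ∀ c ∈ k.1, ∀ x ∈ σ.cached c, W x.1 x.2 = W' x.1 x.2) :
    W (d k) = W' (d k) := by
  refine eq_of_condEntropy_eq_zero σ.fullLaw _ _ (hσ k)
    (σ.fullLaw_apply_ne_zero d W hr) (σ.fullLaw_apply_ne_zero d W' hr) ?_
  simp only [Prod.mk.injEq, true_and]
  refine ⟨?_, funext hA⟩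
  ext c x : 2
  exact hZ c.1 c.2 x.1 x.2

/-- The positions of the symbols of the files demanded by the users in `V` that are missing from
the caches revealed up to the decoding time of the demanding user. -/
def missing (σ : Scheme S N C L B q) (d : Demand N C L) (V : Finset (User C L))
    (time : User C L → ℕ) (revealed : ℕ → Finset (Fin C)) : Finset (Fin N × Fin B) :=
  open scoped Classical in
  Finset.univ.filter fun x => ∃ k ∈ V, d k = x.1 ∧ ∀ c ∈ revealed (time k), x ∉ σ.cached c

section Acyclic

variable [NeZero N] [NeZero q] {σ : Scheme S N C L B q} (hσ : σ.IsCorrect) (d : Demand N C L)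
  (V : Finset (User C L)) (time : User C L → ℕ) {revealed : ℕ → Finset (Fin C)}
  (hmono : Monotone revealed) (hV : ∀ k ∈ V, k.1 ⊆ revealed (time k))

include hσ hmono hV

/-- Acyclicity: the answers determine the missing symbols, given all the others. -/
theorem eq_of_answers_eq {r : Fin σ.randSize} (hr : σ.randLaw r ≠ 0) {W W' : Library N B q}
    (hA : ∀ s, σ.A s d (W, r) = σ.A s d (W', r))
    (hW : ∀ x ∉ σ.missing d V time revealed, W x.1 x.2 = W' x.1 x.2) : W = W' := by
  have hfile : ∀ n, ∀ k ∈ V, time k = n → W (d k) = W' (d k) := by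
    intro n
    induction n using Nat.strong_induction_on with
    | _ n ih =>
      rintro k hk rfl
      refine hσ.decode d hr hA k fun c hc x hx => ?_
      by_cases hm : x ∈ σ.missing d V time revealed
      · obtain ⟨k', hk', hd, hcache⟩ := (Finset.mem_filter.1 hm).2
        -- Otherwise the cache `c` of `k`, which holds `x`, would be revealed by the time of `k'`,
        -- and `x` would not be missing for `k'`.
        have hlt : time k' < time k := by
          by_contra hle
          exact hcache c (hmono (not_lt.1 hle) (hV k hk hc)) hx
        rw [← hd, ih _ hlt k' hk' rfl]
      · exact hW x hm
  funext n j
  by_cases hm : (n, j) ∈ σ.missing d V time revealed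
  · obtain ⟨k, hk, hd, -⟩ := (Finset.mem_filter.1 hm).2
    have hd : d k = n := hd
    rw [← hd, hfile _ k hk rfl]
  · exact hW (n, j) hm

/-- Libraries with the same answers are told apart by their symbols outside `missing`, so there are
at most `q ^ (N * B - card)` of them. -/
theorem card_answers_eq_le {r : Fin σ.randSize} (hr : σ.randLaw r ≠ 0)
    (v : Fin S → Fin σ.answerSize) :
    Fintype.card {W : Library N B q // (fun s => σ.A s d (W, r)) = v} *
        q ^ (σ.missing d V time revealed).card ≤ Fintype.card (Library N B q) := by
  classical
  set P := σ.missing d V time revealed with hP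
  have h1 : Fintype.card {W : Library N B q // (fun s => σ.A s d (W, r)) = v} ≤
      Fintype.card ({x // x ∉ P} → Fin q) := by
    refine Fintype.card_le_of_injective (fun W x => W.1 x.1.1 x.1.2) fun W W' h => Subtype.ext ?_
    refine eq_of_answers_eq hσ d V time hmono hV hr (fun s => ?_) fun x hx => ?_
    · exact congrFun (W.2.trans W'.2.symm) s
    · exact congrFun h ⟨x, hx⟩
  have h2 : Fintype.card {x // x ∉ P} + P.card = N * B := by
    rw [Fintype.card_subtype_compl, Fintype.card_coe, Fintype.card_prod, Fintype.card_fin,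
      Fintype.card_fin, Nat.sub_add_cancel]
    simpa using P.card_le_univ
  calc _ ≤ Fintype.card ({x // x ∉ P} → Fin q) * q ^ P.card := Nat.mul_le_mul_right _ h1
    _ = Fintype.card (Library N B q) := by
      rw [Fintype.card_fun, Fintype.card_fin, ← pow_add, h2]
      simp [← pow_mul, mul_comm]

/-- The acyclic index coding bound: the answers have at least the entropy of the missing
symbols. -/
theorem card_missing_mul_log_le :
    (σ.missing d V time revealed).card * Real.log q ≤ ∑ s, entropy σ.law (σ.A s d) := by
  classical
  set P := σ.missing d V time revealed with hP
  have hq : (0 : ℝ) < q := Nat.cast_pos.2 (NeZero.pos q)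
  have hlib : (0 : ℝ) < Fintype.card (Library N B q) := Nat.cast_pos.2 Fintype.card_pos
  have := neg_log_le_sum_entropy σ.law (fun s => σ.A s d) (p := ((q : ℝ) ^ P.card)⁻¹)
    (by positivity) ?_
  · rwa [Real.log_inv, neg_neg, Real.log_pow] at this
  intro v
  rw [mass_eq_sum, Fintype.sum_prod_type, Finset.sum_comm]
  -- The counting bound holds for each `r` of positive probability, hence on average over `r`.
  calc _ ≤ ∑ r, (σ.randLaw r).toReal * ((q : ℝ) ^ P.card)⁻¹ := by
        refine Finset.sum_le_sum fun r _ => ?_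
        by_cases hr : σ.randLaw r = 0
        · simp [law_apply, hr]
        have hcard := card_answers_eq_le hσ d V time hmono hV hr v
        rw [← hP, Fintype.card_subtype] at hcard
        simp only [law_apply, ENNReal.toReal_mul, ENNReal.toReal_inv, ENNReal.toReal_natCast]
        rw [← Finset.sum_filter, Finset.sum_const, nsmul_eq_mul, ← mul_assoc, mul_comm]
        refine mul_le_mul_of_nonneg_left ?_ ENNReal.toReal_nonneg
        rw [← div_eq_mul_inv, div_le_iff₀ hlib, ← div_eq_inv_mul, le_div_iff₀ (by positivity)]
        exact_mod_cast hcard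
    _ = _ := by rw [← Finset.sum_mul, sum_toReal_eq_one, one_mul]

end Acyclic

/-- The scheme without caching in which every server broadcasts all the files. -/
def downloadAll (S N C L B q : ℕ) : Scheme S N C L B q where
  cached _ := ∅
  randSize := 1
  randLaw := PMF.pure 0
  querySize := 1
  query _ _ _ _ := 0
  answerSize := Fintype.card (Library N B q)
  answer _ _ W := Fintype.equivFin _ W

theorem downloadAll_isPrivate [NeZero N] [NeZero q] : (downloadAll S N C L B q).IsPrivate := by
  intro s
  have : Subsingleton (∀ c, CacheContent q (downloadAll S N C L B q).cached c) :=
    ⟨fun _ _ => funext fun _ => funext fun x => absurd x.2 (Finset.notMem_empty _)⟩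
  have : Subsingleton (Fin (downloadAll S N C L B q).querySize) :=
    inferInstanceAs (Subsingleton (Fin 1))
  exact mutualInfo_of_subsingleton _ _ _

theorem downloadAll_isCorrect [NeZero S] [NeZero N] [NeZero q] :
    (downloadAll S N C L B q).IsCorrect := by
  intro k
  rw [condEntropy, entropy_prod_of_determined, sub_self]
  intro y y' h
  simp only [Prod.mk.injEq] at h
  obtain ⟨hd, -, -, hA⟩ := h
  have hW : y.2.1 = y'.2.1 := (Fintype.equivFin (Library N B q)).injective (congrFun hA 0)
  rw [hd, hW]

end Scheme

/-- Needed because the real `sInf` of the empty set is 0, which would break the lower bound on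
`optimalRate`. -/
theorem achievableRates_nonempty (S N C L : ℕ) [NeZero S] [NeZero N] {M : ℝ} (hM : 0 ≤ M) :
    (achievableRates S N C L M).Nonempty := by
  refine ⟨_, 1, 2, inferInstance, Scheme.downloadAll S N C L 1 2, one_pos, le_rfl, fun c => ?_,
    Scheme.downloadAll_isPrivate, Scheme.downloadAll_isCorrect, rfl⟩
  simpa [Scheme.downloadAll] using hM

end MuPIR
end

/-! ### Averaging over cache orders and file shifts -/

noncomputable section
namespace MuPIR

variable {S N C L B q : ℕ}

namespace User

/-- The caches of the user after relabelling all the caches. -/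
def relabel (π : Equiv.Perm (Fin C)) (U : User C L) : User C L :=
  ⟨U.1.map π.toEmbedding, by rw [Finset.card_map, U.2]⟩

theorem relabel_symm_relabel (π : Equiv.Perm (Fin C)) (U : User C L) :
    relabel π.symm (relabel π U) = U := by
  refine Subtype.ext ?_
  simp [relabel, Finset.map_map]

/-- The number of caches up to the last one that the user accesses. -/
def last (U : User C L) : ℕ := height (U.1.map Fin.valEmbedding)

theorem lt_last {U : User C L} {c : Fin C} (hc : c ∈ U.1) : (c : ℕ) < U.last :=
  Finset.le_sup (f := fun c => c + 1) (Finset.mem_map_of_mem Fin.valEmbedding hc)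

theorem last_le (U : User C L) : U.last ≤ C := by
  refine Finset.sup_le fun c hc => ?_
  obtain ⟨c, -, rfl⟩ := Finset.mem_map.1 hc
  exact c.2

/-- Supplies `1 ≤ i` for the tangent bound, which fails at `i = 0`. -/
theorem one_le_last (hL : 1 ≤ L) (U : User C L) : 1 ≤ U.last := by
  have : 0 < U.1.card := by rw [U.2]; exact hL
  obtain ⟨c, hc⟩ := Finset.card_pos.1 this
  exact Nat.succ_le_of_lt ((Nat.zero_le _).trans_lt (lt_last hc))

theorem sum_choose_sub_last (C L t : ℕ) (hL : 1 ≤ L) :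
    ∑ U : User C L, (C - U.last).choose t = C.choose (t + L) := by
  rw [← sum_choose_sub_height C L t hL]
  refine Finset.sum_bij (fun U _ => U.1.map Fin.valEmbedding) ?_ ?_ ?_ ?_
  · intro U _
    refine Finset.mem_powersetCard.2 ⟨fun c hc => ?_, by rw [Finset.card_map, U.2]⟩
    obtain ⟨c, -, rfl⟩ := Finset.mem_map.1 hc
    exact Finset.mem_range.2 c.2
  · intro U _ U' _ h
    exact Subtype.ext (Finset.map_injective _ h)
  · intro A hA
    obtain ⟨hA, hcard⟩ := Finset.mem_powersetCard.1 hA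
    have hmap : (A.attachFin fun c hc => Finset.mem_range.1 (hA hc)).map Fin.valEmbedding = A :=
      Finset.map_valEmbedding_attachFin _
    exact ⟨⟨A.attachFin fun c hc => Finset.mem_range.1 (hA hc), by simpa using hcard⟩,
      Finset.mem_univ _, hmap⟩
  · intro U _
    rfl

/-- The users all of whose caches are among the first `m`. -/
def initial (C L m : ℕ) : Finset (User C L) := Finset.univ.filter fun U => U.last ≤ m

theorem card_initial_le (C L m : ℕ) : (initial C L m).card ≤ m.choose L := by
  rw [← Finset.card_range m, ← Finset.card_powersetCard, Finset.card_range]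
  refine Finset.card_le_card_of_injOn (fun U => U.1.map Fin.valEmbedding) ?_ ?_
  · intro U hU
    refine Finset.mem_coe.2 (Finset.mem_powersetCard.2
      ⟨fun c hc => ?_, by rw [Finset.card_map, U.2]⟩)
    obtain ⟨c, hcU, rfl⟩ := Finset.mem_map.1 hc
    exact Finset.mem_range.2 ((lt_last hcU).trans_le (Finset.mem_filter.1 hU).2)
  · intro U _ U' _ h
    exact Subtype.ext (Finset.map_injective _ h)

/-- Used with `m = C - t`; this is where the assumption of enough files enters. -/
theorem exists_injOn_initial [NeZero N] {m : ℕ} (h : m.choose L ≤ N) :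
    ∃ f : User C L → Fin N, Set.InjOn f (initial C L m) := by
  classical
  have hcard : Fintype.card {U // U ∈ initial C L m} ≤ Fintype.card (Fin N) := by
    simpa using (card_initial_le C L m).trans h
  obtain ⟨e⟩ := Function.Embedding.nonempty_of_card_le hcard
  refine ⟨fun U => if hU : U ∈ initial C L m then e ⟨U, hU⟩ else 0, fun U hU U' hU' hUU' => ?_⟩
  have hU : U ∈ initial C L m := hU
  have hU' : U' ∈ initial C L m := hU'
  simp only [hU, hU', dif_pos] at hUU'
  exact congrArg Subtype.val (e.injective hUU')

end User

/-- Both sides count pairs of disjoint sets of sizes `a` and `b`. -/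
theorem choose_mul_choose_sub_comm (n a b : ℕ) :
    n.choose a * (n - a).choose b = n.choose b * (n - b).choose a := by
  have h1 := Nat.choose_mul (n := n) (Nat.le_add_right a b)
  have h2 := Nat.choose_mul (n := n) (Nat.le_add_left b a)
  rw [Nat.add_sub_cancel_left] at h1
  rw [Nat.add_sub_cancel] at h2
  rw [← h1, ← h2, Nat.choose_symm_add]

/-- The first `i` caches. -/
def firstCaches (C i : ℕ) : Finset (Fin C) := Finset.univ.filter fun c => (c : ℕ) < i

theorem card_firstCaches {i : ℕ} (h : i ≤ C) : (firstCaches C i).card = i := by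
  rw [firstCaches, Fin.card_filter_val_lt, min_eq_right h]

theorem firstCaches_mono (C : ℕ) : Monotone (firstCaches C) := fun i j hij c hc => by
  rw [firstCaches, Finset.mem_filter] at hc ⊢
  exact ⟨hc.1, hc.2.trans_le hij⟩

namespace Scheme

/-- The caches that hold a given file symbol. -/
def holders (σ : Scheme S N C L B q) (x : Fin N × Fin B) : Finset (Fin C) :=
  Finset.univ.filter fun c => x ∈ σ.cached c

theorem sum_card_holders (σ : Scheme S N C L B q) :
    ∑ x, (σ.holders x).card = ∑ c, (σ.cached c).card := by
  simp_rw [holders, Finset.card_filter]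
  rw [Finset.sum_comm]
  simp

theorem rate_le_worstCaseRate [NeZero q] (σ : Scheme S N C L B q) (d : Demand N C L) :
    σ.rate d ≤ σ.worstCaseRate :=
  le_ciSup (f := σ.rate) (Set.finite_range _).bddAbove d

/-- The acyclic bound for the users in `User.initial C L m`, who demand distinct files, after
relabelling the caches by `π` and shifting the files by `a`. -/
theorem sum_disjoint_le [NeZero N] [NeZero q] {σ : Scheme S N C L B q} (hσ : σ.IsCorrect)
    (hB : 0 < B) (hq : 2 ≤ q) {m : ℕ} {f : User C L → Fin N}
    (hf : Set.InjOn f (User.initial C L m)) (π : Equiv.Perm (Fin C)) (a : Fin N) :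
    ∑ U ∈ User.initial C L m, ∑ j,
      (if Disjoint ((firstCaches C U.last).map π.toEmbedding) (σ.holders (a + f U, j))
        then (1 : ℝ) else 0) ≤ σ.worstCaseRate * B := by
  classical
  -- Everything is transported along `π`: the user `U.relabel π` demands `a + f U`, and the caches
  -- are revealed in the order `π 0, π 1, …`.
  let d : Demand N C L := fun k => a + f (k.relabel π.symm)
  let V : Finset (User C L) := (User.initial C L m).image (User.relabel π)
  let time : User C L → ℕ := fun k => (k.relabel π.symm).last
  let revealed : ℕ → Finset (Fin C) := fun i => (firstCaches C i).map π.toEmbedding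
  have hmono : Monotone revealed := fun i j hij =>
    Finset.map_subset_map.2 (firstCaches_mono C hij)
  have hV : ∀ k ∈ V, k.1 ⊆ revealed (time k) := by
    intro k hk
    obtain ⟨U, -, rfl⟩ := Finset.mem_image.1 hk
    simp only [time, revealed, User.relabel_symm_relabel]
    refine Finset.map_subset_map.2 fun c hc => ?_
    exact Finset.mem_filter.2 ⟨Finset.mem_univ c, User.lt_last hc⟩
  have hent := card_missing_mul_log_le hσ d V time hmono hV
  have hlog : 0 < Real.log q := Real.log_pos (by exact_mod_cast hq)
  have hB' : (0 : ℝ) < B := Nat.cast_pos.2 hB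
  have hrate := σ.rate_le_worstCaseRate d
  rw [rate, div_le_iff₀ (by positivity), ← mul_assoc] at hrate
  refine le_trans ?_ (le_of_mul_le_mul_right (hent.trans hrate) hlog)
  rw [← Finset.sum_product', Finset.sum_boole, Nat.cast_le]
  refine Finset.card_le_card_of_injOn (fun y => (a + f y.1, y.2)) ?_ ?_
  · rintro ⟨U, j⟩ hy
    obtain ⟨hU, hdisj⟩ := Finset.mem_filter.1 (Finset.mem_coe.1 hy)
    refine Finset.mem_coe.2 (Finset.mem_filter.2 ⟨Finset.mem_univ _, U.relabel π,
      Finset.mem_image_of_mem _ (Finset.mem_product.1 hU).1, ?_, ?_⟩)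
    · simp only [d, User.relabel_symm_relabel]
    · intro c hc hx
      simp only [time, revealed, User.relabel_symm_relabel] at hc
      exact Finset.disjoint_left.1 hdisj hc (Finset.mem_filter.2 ⟨Finset.mem_univ c, hx⟩)
  · rintro ⟨U, j⟩ hy ⟨U', j'⟩ hy' h
    have hU := (Finset.mem_product.1 (Finset.mem_filter.1 (Finset.mem_coe.1 hy)).1).1
    have hU' := (Finset.mem_product.1 (Finset.mem_filter.1 (Finset.mem_coe.1 hy')).1).1
    simp only [Prod.mk.injEq, add_right_inj] at h
    exact Prod.ext (hf hU hU' h.1) h.2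

/-- The number of relabellings that make a symbol missing, summed over the symbols. -/
theorem le_sum_perm_disjoint {σ : Scheme S N C L B q} {t i : ℕ} (htC : t ≤ C) (hi : 1 ≤ i)
    (hiC : i + t ≤ C) (hsum : ∑ x, ((σ.holders x).card : ℝ) ≤ t * (N * B)) :
    (C.factorial : ℝ) * (N * B) * ((C - i).choose t / C.choose t) ≤
      ∑ x, ∑ π : Equiv.Perm (Fin C),
        (if Disjoint ((firstCaches C i).map π.toEmbedding) (σ.holders x) then (1 : ℝ) else 0) := by
  have hi0 : (0 : ℝ) < C.choose i := Nat.cast_pos.2 (Nat.choose_pos (by omega))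
  have ht0 : (0 : ℝ) < C.choose t := Nat.cast_pos.2 (Nat.choose_pos htC)
  have hcomm : (C.choose i : ℝ) * (C - i).choose t = C.choose t * (C - t).choose i := by
    exact_mod_cast choose_mul_choose_sub_comm C i t
  have hjensen := card_mul_choose_le_sum_choose hi htC (fun x => (σ.holders x).card)
    (fun x => by simpa using (σ.holders x).card_le_univ) (by simpa using hsum)
  simp only [Fintype.card_prod, Fintype.card_fin, Nat.cast_mul] at hjensen
  have hperm := fun x => choose_mul_card_perm_disjoint (firstCaches C i) (σ.holders x)
  simp only [Fintype.card_fin, card_firstCaches (show i ≤ C by omega)] at hperm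
  refine le_of_mul_le_mul_left ?_ hi0
  rw [Finset.mul_sum]
  simp_rw [hperm]
  rw [← Finset.mul_sum]
  calc _ = (C.factorial : ℝ) * ((N * B) * (C - t).choose i) := by
        field_simp
        linear_combination (N : ℝ) * B * hcomm
    _ ≤ _ := mul_le_mul_of_nonneg_left hjensen (Nat.cast_nonneg _)

/-- The converse bound for multi-access coded caching with uncoded placement. -/
theorem le_worstCaseRate [NeZero N] [NeZero q] {σ : Scheme S N C L B q} (hσ : σ.IsCorrect)
    {M : ℝ} (hmem : σ.FitsMemory M) (hB : 0 < B) (hq : 2 ≤ q) {t : ℕ} (hL : 1 ≤ L)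
    (htC : t ≤ C) (htM : (t : ℝ) = C * M / N) (hN : (C - t).choose L ≤ N) :
    (C.choose (t + L) : ℝ) / C.choose t ≤ σ.worstCaseRate := by
  have hN0 : (0 : ℝ) < N := Nat.cast_pos.2 (NeZero.pos N)
  have hB0 : (0 : ℝ) < B := Nat.cast_pos.2 hB
  obtain ⟨f, hf⟩ := User.exists_injOn_initial (C := C) hN
  -- The caches hold at most `C * M * B = t * N * B` symbols in total.
  have hsum : ∑ x, ((σ.holders x).card : ℝ) ≤ t * (N * B) := by
    have h : ∑ x, ((σ.holders x).card : ℝ) = ∑ c, ((σ.cached c).card : ℝ) := by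
      exact_mod_cast σ.sum_card_holders
    rw [h]
    refine (Finset.sum_le_sum fun c _ => hmem c).trans (le_of_eq ?_)
    rw [htM]
    simp
    field_simp
  have hupper := Finset.sum_le_sum fun (π : Equiv.Perm (Fin C)) (_ : π ∈ Finset.univ) =>
    Finset.sum_le_sum fun (a : Fin N) (_ : a ∈ Finset.univ) => sum_disjoint_le hσ hB hq hf π a
  have hswap : (∑ π : Equiv.Perm (Fin C), ∑ a : Fin N, ∑ U ∈ User.initial C L (C - t), ∑ j,
      (if Disjoint ((firstCaches C U.last).map π.toEmbedding) (σ.holders (a + f U, j))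
        then (1 : ℝ) else 0)) = ∑ U ∈ User.initial C L (C - t), ∑ x,
      ∑ π : Equiv.Perm (Fin C),
      (if Disjoint ((firstCaches C U.last).map π.toEmbedding) (σ.holders x)
        then (1 : ℝ) else 0) := by
    rw [Finset.sum_congr rfl fun π _ => Finset.sum_comm, Finset.sum_comm]
    refine Finset.sum_congr rfl fun U _ => ?_
    rw [Finset.sum_comm (s := Finset.univ (α := Fin N × Fin B))]
    refine Finset.sum_congr rfl fun π _ => ?_
    rw [Fintype.sum_prod_type]
    -- For fixed `U`, the shifted file `a + f U` runs through all files, so only the mean of the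
    -- holder counts matters.
    exact Equiv.sum_comp (Equiv.addRight (f U)) fun n => ∑ j,
      if Disjoint ((firstCaches C U.last).map π.toEmbedding) (σ.holders (n, j))
        then (1 : ℝ) else 0
  have hlower : ∑ U ∈ User.initial C L (C - t),
      (C.factorial : ℝ) * (N * B) * ((C - U.last).choose t / C.choose t) ≤ _ :=
    Finset.sum_le_sum fun U hU => le_sum_perm_disjoint htC (U.one_le_last hL)
      (by have := (Finset.mem_filter.1 hU).2; omega) hsum
  -- Users with `U.last > C - t` contribute `(C - U.last).choose t = 0`, so leaving them out loses
  -- nothing.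
  have hcount : ∑ U ∈ User.initial C L (C - t), ((C - U.last).choose t : ℝ) =
      C.choose (t + L) := by
    rw [← User.sum_choose_sub_last C L t hL, Nat.cast_sum]
    refine Finset.sum_subset (Finset.subset_univ _) fun U _ hU => ?_
    have : ¬ U.last ≤ C - t := fun h => hU (Finset.mem_filter.2 ⟨Finset.mem_univ U, h⟩)
    have := U.last_le
    rw [Nat.choose_eq_zero_of_lt (by omega), Nat.cast_zero]
  rw [hswap] at hupper
  have h := hlower.trans hupper
  rw [← Finset.mul_sum, ← Finset.sum_div, hcount] at h
  simp only [Finset.sum_const, Finset.card_univ, Fintype.card_perm, Fintype.card_fin,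
    nsmul_eq_mul] at h
  have hpos : (0 : ℝ) < C.factorial * (N * B) := by positivity
  refine le_of_mul_le_mul_left (h.trans (le_of_eq ?_)) hpos
  ring

end Scheme

/-! ### The geometric factor and the conclusion -/

theorem sum_one_div_pow_le_two {S : ℕ} (hS : 2 ≤ S) (N : ℕ) :
    ∑ n ∈ Finset.range N, 1 / (S : ℝ) ^ n ≤ 2 := by
  have hS' : (2 : ℝ) ≤ S := by exact_mod_cast hS
  refine le_trans (Finset.sum_le_sum fun n _ => ?_) (sum_geometric_two_le N)
  rw [one_div_pow]
  gcongr

end MuPIR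
end

theorem theorem2 (S N C L t : ℕ) [NeZero N] (M : ℝ) (hS : 2 ≤ S) (hL : 1 ≤ L) (hLC : L < C)
    (htC : t ≤ C) (htM : (t : ℝ) = C * M / N) (hN : (C - t).choose L ≤ N) :
    MuPIR.schemeRate S N C L t ≤ 2 * MuPIR.optimalRate S N C L M := by
  have : NeZero S := ⟨by omega⟩
  have hN0 : (0 : ℝ) < N := Nat.cast_pos.2 (NeZero.pos N)
  have hC0 : (0 : ℝ) < C := Nat.cast_pos.2 (by omega)
  have hM : 0 ≤ M := by
    rw [eq_div_iff hN0.ne'] at htM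
    exact nonneg_of_mul_nonneg_right (htM ▸ by positivity) hC0
  have hopt : (C.choose (t + L) : ℝ) / C.choose t ≤ MuPIR.optimalRate S N C L M := by
    refine le_csInf (MuPIR.achievableRates_nonempty S N C L hM) ?_
    -- Privacy is dropped: the converse needs only memory and correctness.
    rintro _ ⟨B, q, _, σ, hB, hq, hmem, -, hσ, rfl⟩
    exact MuPIR.Scheme.le_worstCaseRate hσ hmem hB hq hL htC htM hN
  calc _ ≤ (C.choose (t + L) : ℝ) / C.choose t * 2 :=
        mul_le_mul_of_nonneg_left (MuPIR.sum_one_div_pow_le_two hS N) (by positivity)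
    _ ≤ _ := by linarith
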